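/- Let $m,n\ge 0$ be integers, let $f:\mathbb{R}^n\to\mathbb{R}\cup\{+\infty\}$ be proper, lower semicontinuous and convex, and let $A\in\mathbb{R}^{m\times n}$, where $\mathbb{R}^n$ and $\mathbb{R}^m$ carry the Euclidean inner product $\langle\cdot,\cdot\rangle$ and norm $\|\cdot\|$. For $b\in\mathbb{R}^m$ let $$X_b=\operatorname*{Arg\,min}_{x\in\mathbb{R}^n}\Big( f(x)+\tfrac12\|Ax-b\|^2\Big)$$ be the (possibly empty) set of global minimizers. Let $f^*(u)=\sup_{x}\big(\langle x,u\rangle-f(x)\big)$ be the conjugate of $f$. For a proper function $g$ let $\partial g(x)=\{u: g(x)+\langle y-x,u\rangle\le g(y)\ \text{for all } y\}$ be its subdifferential, and for a set-valued operator $T$ let $\operatorname{ran}T=\bigcup_x T(x)$. Let $(\partial f+A^\top A)(x)=\partial f(x)+A^\top Ax$ and $(A\circ\partial f^*\circ A^\top)(u)=\{Ax: x\in\partial f^*(A^\top u)\}$. An operator $T:\mathbb{R}^m\to 2^{\mathbb{R}^m}$ is monotone if $\langle x-y,u-v\rangle\ge 0$ whenever $u\in T(x)$, $v\in T(y)$,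 and maximally monotone if moreover its graph is not properly contained in the graph of another monotone operator. Write $\operatorname{ri}S$ for the interior of $S$ relative to its affine hull, and $S-S'=\{s-s': s\in S,\ s'\in S'\}$. Then: (i) $X_b\neq\varnothing$ for every $b\in\mathbb{R}^m$ if and only if $\operatorname{ran}(\partial f+A^\top A)\supseteq\operatorname{ran}A^\top$. (ii) $X_b\neq\varnothing$ for every $b\in\mathbb{R}^m$ if and only if $\operatorname{ran}\partial f\cap\operatorname{ran}A^\top\neq\varnothing$ and $A\circ\partial f^*\circ A^\top:\mathbb{R}^m\to 2^{\mathbb{R}^m}$ is maximally monotone. (iii) If $0\in\operatorname{ri}(\operatorname{ran}\partial f-\operatorname{ran}A^\top)$, then $X_b\neq\varnothing$ for every $b\in\mathbb{R}^m$. Moreover, $0\in\operatorname{ri}(\operatorname{ran}\partial f-\operatorname{ran}A^\top)$ if and only if $(\operatorname{ri}\operatorname{ran}\partial f)\cap\operatorname{ran}A^\top\neq\varnothing$. (iv) If $0\in\operatorname{ri}\operatorname{ran}\partial f$, then $X_b\neq\varnothing$ for every $b\in\mathbb{R}^m$. -/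

import Mathlib

open scoped Matrix Pointwise InnerProductSpace

noncomputable section

namespace RegLS

section General

variable {E F : Type*} [NormedAddCommGroup E] [InnerProductSpace ℝ E]
  [NormedAddCommGroup F] [InnerProductSpace ℝ F]

/-- The class `Γ₀(E)` of proper, lower semicontinuous, convex functions `E → ℝ ∪ {+∞}`.
Convexity of an extended-real-valued function is convexity of its epigraph in `E × ℝ`. -/
structure IsGammaZero (f : E → EReal) : Prop where
  ne_bot : ∀ x, f x ≠ ⊥
  exists_ne_top : ∃ x, f x ≠ ⊤
  lsc : LowerSemicontinuous f
  convex_epigraph : Convex ℝ {p : E × ℝ | f p.1 ≤ (p.2 : EReal)}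

/-- The subdifferential `∂f : E → 2^E` of a proper function `f`:
`u ∈ ∂f(x)` iff `f(x) + ⟪y - x, u⟫ ≤ f(y)` for all `y`. -/
def subdifferential (f : E → EReal) : E → Set E :=
  fun x => {u | ∀ y, f x + ((⟪y - x, u⟫_ℝ : ℝ) : EReal) ≤ f y}

/-- The Fenchel conjugate `f*(u) = sup_x (⟪x, u⟫ - f(x))`. -/
def conjugate (f : E → EReal) : E → EReal :=
  fun u => ⨆ x, (((⟪x, u⟫_ℝ : ℝ) : EReal) - f x)

/-- The range `⋃ₓ T(x)` of a set-valued operator. -/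
def ran (T : E → Set F) : Set F := ⋃ x, T x

/-- Monotonicity of a set-valued operator. -/
def IsMonotone (T : E → Set E) : Prop :=
  ∀ x y, ∀ u ∈ T x, ∀ v ∈ T y, 0 ≤ ⟪x - y, u - v⟫_ℝ

/-- Maximal monotonicity: maximal among the monotone operators, ordered by inclusion of graphs
(that is, by pointwise inclusion of values). -/
def IsMaximallyMonotone (T : E → Set E) : Prop :=
  Maximal IsMonotone T

end General

/-- The linear map `ℝⁿ → ℝᵐ` between Euclidean spaces given by an `m × n` matrix. -/
abbrev lin {m n : ℕ} (A : Matrix (Fin m) (Fin n) ℝ) :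
    EuclideanSpace ℝ (Fin n) →ₗ[ℝ] EuclideanSpace ℝ (Fin m) :=
  Matrix.toEuclideanLin A

/-- The set of (global) minimizers of `x ↦ f(x) + ½‖Ax - b‖²` over `ℝⁿ`. -/
def solutionSet {m n : ℕ} (f : EuclideanSpace ℝ (Fin n) → EReal)
    (A : Matrix (Fin m) (Fin n) ℝ) (b : EuclideanSpace ℝ (Fin m)) :
    Set (EuclideanSpace ℝ (Fin n)) :=
  {x | ∀ y, f x + (((1 / 2 : ℝ) * ‖lin A x - b‖ ^ 2 : ℝ) : EReal)
    ≤ f y + (((1 / 2 : ℝ) * ‖lin A y - b‖ ^ 2 : ℝ) : EReal)}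

/-- The set-valued operator `∂f + AᵀA` on `ℝⁿ`. -/
def subdiffAddGram {m n : ℕ} (f : EuclideanSpace ℝ (Fin n) → EReal)
    (A : Matrix (Fin m) (Fin n) ℝ) :
    EuclideanSpace ℝ (Fin n) → Set (EuclideanSpace ℝ (Fin n)) :=
  fun x => subdifferential f x + {lin (Aᵀ * A) x}

/-- The set-valued operator `A ∘ ∂f* ∘ Aᵀ` on `ℝᵐ`. -/
def conjSubdiffComp {m n : ℕ} (f : EuclideanSpace ℝ (Fin n) → EReal)
    (A : Matrix (Fin m) (Fin n) ℝ) :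
    EuclideanSpace ℝ (Fin m) → Set (EuclideanSpace ℝ (Fin m)) :=
  fun u => lin A '' subdifferential (conjugate f) (lin Aᵀ u)

end RegLS

end

/-!
Write `L = A`, `M = Aᵀ`, and let `D = ran ∂f`, `V = ran M`. By Fermat's rule a point `x` minimizes
`f + ½‖L · - b‖²` exactly when `M (b - L x) ∈ ∂f(x)` (`IsGammaZero.isMin_add_quad_iff`), which is
the first characterization.

For the second, such an `x` yields `u = b - L x` with `b - u ∈ L(∂f*(M u))`, so solvability for all
`b` says that `Id + L ∘ ∂f* ∘ M` is onto, and a monotone operator with this property is maximal.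
Conversely `L ∘ ∂f* ∘ M ⊆ ∂(f* ∘ M)`, the right-hand side is monotone, and `f* ∘ M` has proximal
points; under maximality these solve the original problem
(`IsGammaZero.forall_exists_subgradient_iff`). That `∂f*` inverts `∂f` follows from the existence
of proximal points and monotonicity, so no biconjugate theorem is needed.

The interior-point conditions rest on `IsGammaZero.exists_subgradient`, a Tikhonov argument in the
style of Brezis and Haraux. Minimizers `x_δ` of the problem regularized by `(δ/2)‖·‖²` exist because
`f` is bounded below by a function of linear growth. If a relative neighbourhood of `0` lies in
`dom f* - V`, each small direction `w` gives an affine minorant of `f` with slope in `w + V`, and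
comparing values bounds `⟪x_δ, w⟫` from above. Hence `x_δ` stays bounded as `δ → 0` and a cluster
point is a solution, because the graph of `∂f` is closed. With `L = 0` the same statement gives
`ri dom f* ⊆ D ⊆ dom f*`, the near convexity of `D`, and this allows the usual convex arguments
relating `0 ∈ ri (D - V)` to `ri D ∩ V ≠ ∅` (`IsGammaZero.zero_mem_intrinsicInterior_sub_iff`).
-/

namespace RegLS

/-! ### Functions in `Γ₀(E)` and their subdifferentials -/

section Basic

variable {E F : Type*} [NormedAddCommGroup E] [InnerProductSpace ℝ E]
  [NormedAddCommGroup F] [InnerProductSpace ℝ F] {f : E → EReal}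

theorem IsGammaZero.exists_eq_coe (hf : IsGammaZero f) : ∃ x, ∃ a : ℝ, f x = a := by
  obtain ⟨x, hx⟩ := hf.exists_ne_top
  exact ⟨x, (f x).toReal, (EReal.coe_toReal hx (hf.ne_bot x)).symm⟩

theorem IsGammaZero.convex_comb_le (hf : IsGammaZero f) {x y : E} {a b s t : ℝ}
    (hx : f x ≤ a) (hy : f y ≤ b) (hs : 0 ≤ s) (ht : 0 ≤ t) (hst : s + t = 1) :
    f (s • x + t • y) ≤ ((s * a + t * b : ℝ) : EReal) := by
  have h := hf.convex_epigraph (x := (x, a)) (y := (y, b)) hx hy hs ht hst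
  simpa using h

/-- Membership in the subdifferential, expressed with real numbers only. -/
theorem IsGammaZero.mem_subdifferential_iff (hf : IsGammaZero f) {x u : E} :
    u ∈ subdifferential f x ↔
      ∃ a : ℝ, f x = a ∧ ∀ y, ((a + ⟪y - x, u⟫_ℝ : ℝ) : EReal) ≤ f y := by
  constructor
  · intro h
    obtain ⟨z, hz⟩ := hf.exists_ne_top
    have hx : f x ≠ ⊤ := by
      intro hx
      have := h z
      rw [hx, EReal.top_add_coe, top_le_iff] at this
      exact hz this
    refine ⟨(f x).toReal, (EReal.coe_toReal hx (hf.ne_bot x)).symm, fun y => ?_⟩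
    rw [EReal.coe_add, EReal.coe_toReal hx (hf.ne_bot x)]
    exact h y
  · rintro ⟨a, ha, h⟩ y
    rw [ha, ← EReal.coe_add]
    exact h y

theorem IsGammaZero.isMonotone_subdifferential (hf : IsGammaZero f) :
    IsMonotone (subdifferential f) := by
  intro x y u hu v hv
  obtain ⟨a, ha, hu⟩ := hf.mem_subdifferential_iff.1 hu
  obtain ⟨b, hb, hv⟩ := hf.mem_subdifferential_iff.1 hv
  have h1 := hu y
  have h2 := hv x
  rw [hb, EReal.coe_le_coe_iff] at h1
  rw [ha, EReal.coe_le_coe_iff] at h2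
  simp only [inner_sub_left, inner_sub_right] at *
  linarith

/-- The graph of the subdifferential is sequentially closed. -/
theorem IsGammaZero.mem_subdifferential_of_tendsto (hf : IsGammaZero f) {x u : ℕ → E} {x₀ u₀ : E}
    (h : ∀ k, u k ∈ subdifferential f (x k)) (hx : Filter.Tendsto x Filter.atTop (nhds x₀))
    (hu : Filter.Tendsto u Filter.atTop (nhds u₀)) : u₀ ∈ subdifferential f x₀ := by
  -- Lower semicontinuity enters through closedness of the epigraph.
  have key : ∀ y, ∀ s : ℝ, f y = s → f x₀ ≤ ((s - ⟪y - x₀, u₀⟫_ℝ : ℝ) : EReal) := by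
    intro y s hs
    have hlim : Filter.Tendsto (fun k => (x k, ((s - ⟪y - x k, u k⟫_ℝ : ℝ) : EReal)))
        Filter.atTop (nhds (x₀, ((s - ⟪y - x₀, u₀⟫_ℝ : ℝ) : EReal))) := by
      refine hx.prodMk_nhds ?_
      rw [EReal.tendsto_coe]
      exact tendsto_const_nhds.sub ((tendsto_const_nhds.sub hx).inner hu)
    refine hf.lsc.isClosed_epigraph.mem_of_tendsto hlim (Filter.Eventually.of_forall fun k => ?_)
    obtain ⟨a, ha, h'⟩ := hf.mem_subdifferential_iff.1 (h k)
    have := h' y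
    rw [hs, EReal.coe_le_coe_iff] at this
    show f (x k) ≤ _
    rw [ha, EReal.coe_le_coe_iff]
    linarith
  obtain ⟨z, c, hz⟩ := hf.exists_eq_coe
  have hx₀ : f x₀ ≠ ⊤ := ne_top_of_le_ne_top (EReal.coe_ne_top _) (key z c hz)
  have ha := (EReal.coe_toReal hx₀ (hf.ne_bot x₀)).symm
  refine hf.mem_subdifferential_iff.2 ⟨_, ha, fun y => ?_⟩
  rcases eq_or_ne (f y) ⊤ with hy | hy
  · rw [hy]; exact le_top
  · have hs := (EReal.coe_toReal hy (hf.ne_bot y)).symm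
    have := key y _ hs
    rw [ha, EReal.coe_le_coe_iff] at this
    rw [hs, EReal.coe_le_coe_iff]
    linarith

/-- A function in `Γ₀(E)` decreases at most linearly. -/
theorem IsGammaZero.exists_linear_lower_bound [FiniteDimensional ℝ E] (hf : IsGammaZero f) :
    ∃ K : ℝ, 0 ≤ K ∧ ∀ x, ((-(K * (1 + ‖x‖)) : ℝ) : EReal) ≤ f x := by
  obtain ⟨x₀, a, ha⟩ := hf.exists_eq_coe
  obtain ⟨z, -, hz⟩ := LowerSemicontinuousOn.exists_isMinOn (f := f)
    (s := Metric.closedBall x₀ 1) ⟨x₀, by simp⟩ (isCompact_closedBall x₀ 1)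
    (hf.lsc.lowerSemicontinuousOn _)
  have hza : f z ≤ a := ha ▸ hz (show x₀ ∈ Metric.closedBall x₀ 1 by simp)
  have hzt : f z ≠ ⊤ := ne_top_of_le_ne_top (EReal.coe_ne_top _) hza
  set c := (f z).toReal with hc
  have hfc : f z = c := (EReal.coe_toReal hzt (hf.ne_bot z)).symm
  rw [hfc, EReal.coe_le_coe_iff] at hza
  have hball : ∀ w ∈ Metric.closedBall x₀ 1, (c : EReal) ≤ f w := fun w hw => hfc ▸ hz hw
  have main : ∀ x, ((c - (a - c) * ‖x - x₀‖ : ℝ) : EReal) ≤ f x := by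
    intro x
    rcases le_or_gt ‖x - x₀‖ 1 with h | h
    · refine le_trans ?_ (hball x (by rwa [Metric.mem_closedBall, dist_eq_norm]))
      rw [EReal.coe_le_coe_iff]
      nlinarith [norm_nonneg (x - x₀)]
    · rcases eq_or_ne (f x) ⊤ with hx | hx
      · rw [hx]; exact le_top
      have hs := (EReal.coe_toReal hx (hf.ne_bot x)).symm
      set r := ‖x - x₀‖
      set s := (f x).toReal
      have hr : 0 < r := by linarith
      -- Compare with the point where the segment from `x₀` to `x` leaves the unit ball.
      have hcomb := hf.convex_comb_le ha.le hs.le (s := 1 - r⁻¹) (t := r⁻¹)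
        (by linarith [inv_le_one_of_one_le₀ h.le]) (by positivity) (by ring)
      have hw : (1 - r⁻¹) • x₀ + r⁻¹ • x ∈ Metric.closedBall x₀ 1 := by
        rw [Metric.mem_closedBall, dist_eq_norm,
          show (1 - r⁻¹) • x₀ + r⁻¹ • x - x₀ = r⁻¹ • (x - x₀) by module, norm_smul,
          Real.norm_of_nonneg (by positivity)]
        exact (inv_mul_cancel₀ hr.ne').le
      have h1 := (hball _ hw).trans hcomb
      rw [EReal.coe_le_coe_iff] at h1
      rw [hs, EReal.coe_le_coe_iff]
      have h2 : r * c ≤ r * ((1 - r⁻¹) * a + r⁻¹ * s) := mul_le_mul_of_nonneg_left h1 hr.le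
      have h3 : r * ((1 - r⁻¹) * a + r⁻¹ * s) = (r - 1) * a + s := by field_simp
      nlinarith
  refine ⟨|c| + (a - c) * (1 + ‖x₀‖), by positivity [sub_nonneg.2 hza], fun x => le_trans ?_ (main x)⟩
  rw [EReal.coe_le_coe_iff]
  have h1 : ‖x - x₀‖ ≤ ‖x‖ + ‖x₀‖ := norm_sub_le _ _
  have h2 : 0 ≤ a - c := sub_nonneg.2 hza
  nlinarith [neg_abs_le c, norm_nonneg x, norm_nonneg x₀, abs_nonneg c,
    mul_nonneg (mul_nonneg h2 (norm_nonneg x₀)) (norm_nonneg x),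
    mul_nonneg (abs_nonneg c) (norm_nonneg x), mul_le_mul_of_nonneg_left h1 h2]

end Basic

/-! ### Adding a convex quadratic -/

section Quadratic

variable {E F : Type*} [NormedAddCommGroup E] [InnerProductSpace ℝ E]
  [NormedAddCommGroup F] [InnerProductSpace ℝ F] {f : E → EReal}

/-- The regularized, linearly perturbed least-squares term
`x ↦ ½‖L x - b‖² + (δ/2)‖x‖² - ⟪x, p⟫`. -/
noncomputable def quad (L : E →ₗ[ℝ] F) (b : F) (δ : ℝ) (p x : E) : ℝ :=
  1 / 2 * ‖L x - b‖ ^ 2 + δ / 2 * ‖x‖ ^ 2 - ⟪x, p⟫_ℝ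

/-- The exact second-order expansion of `quad`, where `M` is the adjoint of `L`. -/
theorem quad_eq {L : E →ₗ[ℝ] F} {M : F →ₗ[ℝ] E} (hLM : ∀ x y, ⟪L x, y⟫_ℝ = ⟪x, M y⟫_ℝ)
    (b : F) (δ : ℝ) (p x y : E) :
    quad L b δ p y = quad L b δ p x - ⟪y - x, p + M (b - L x) - δ • x⟫_ℝ
      + (1 / 2 * ‖L (y - x)‖ ^ 2 + δ / 2 * ‖y - x‖ ^ 2) := by
  have h : ⟪y - x, M (b - L x)⟫_ℝ = ⟪L y - L x, b - L x⟫_ℝ := by rw [← hLM, map_sub]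
  rw [inner_sub_right, inner_add_right, h]
  unfold quad
  rw [map_sub]
  simp only [← real_inner_self_eq_norm_sq, inner_sub_left, inner_sub_right, inner_smul_right]
  rw [real_inner_comm (L x) (L y), real_inner_comm x y, real_inner_comm (L x) b,
    real_inner_comm (L y) b]
  ring

/-- Fermat's rule for the sum of a function in `Γ₀(E)` and a convex quadratic. -/
theorem IsGammaZero.isMin_add_quad_iff (hf : IsGammaZero f) {L : E →ₗ[ℝ] F} {M : F →ₗ[ℝ] E}
    (hLM : ∀ x y, ⟪L x, y⟫_ℝ = ⟪x, M y⟫_ℝ) (b : F) {δ : ℝ} (hδ : 0 ≤ δ) (p x : E) :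
    (∀ y, f x + (quad L b δ p x : EReal) ≤ f y + (quad L b δ p y : EReal)) ↔
      p + M (b - L x) - δ • x ∈ subdifferential f x := by
  constructor
  · intro h
    have hx : f x ≠ ⊤ := by
      intro hx
      obtain ⟨z, c, hz⟩ := hf.exists_eq_coe
      have := h z
      rw [hx, hz, EReal.top_add_coe, top_le_iff, ← EReal.coe_add] at this
      exact EReal.coe_ne_top _ this
    have ha := (EReal.coe_toReal hx (hf.ne_bot x)).symm
    set a := (f x).toReal
    refine hf.mem_subdifferential_iff.2 ⟨a, ha, fun y => ?_⟩
    rcases eq_or_ne (f y) ⊤ with hy | hy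
    · rw [hy]; exact le_top
    have hs := (EReal.coe_toReal hy (hf.ne_bot y)).symm
    set s := (f y).toReal
    rw [hs, EReal.coe_le_coe_iff]
    set g := p + M (b - L x) - δ • x
    set R := 1 / 2 * ‖L (y - x)‖ ^ 2 + δ / 2 * ‖y - x‖ ^ 2 with hR
    have hR0 : 0 ≤ R := by positivity
    have hstep : ∀ t : ℝ, 0 < t → t ≤ 1 → 0 ≤ (s - a - ⟪y - x, g⟫_ℝ) + t * R := by
      intro t ht ht1
      have h1 := hf.convex_comb_le ha.le hs.le (sub_nonneg.2 ht1) ht.le (by ring)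
      have h2 := (h ((1 - t) • x + t • y)).trans (add_le_add_left h1 _)
      rw [ha, ← EReal.coe_add, ← EReal.coe_add, EReal.coe_le_coe_iff,
        quad_eq hLM b δ p x ((1 - t) • x + t • y),
        show (1 - t) • x + t • y - x = t • (y - x) by module, map_smul, norm_smul, norm_smul,
        inner_smul_left, Real.norm_of_nonneg ht.le] at h2
      simp only [conj_trivial] at h2
      have h3 : 0 ≤ t * ((s - a - ⟪y - x, g⟫_ℝ) + t * R) := by
        rw [hR]; linarith
      exact nonneg_of_mul_nonneg_right h3 ht
    by_contra hcon
    set c := s - a - ⟪y - x, g⟫_ℝ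
    have hc : c < 0 := by simp only [c]; linarith
    have hd : 0 < R - c := by linarith
    have h4 := hstep (-c / (R - c)) (div_pos (by linarith) hd) ((div_le_one hd).2 (by linarith))
    have h5 : c + -c / (R - c) * R = -(c * c) / (R - c) := by field_simp; ring
    rw [h5] at h4
    have h6 : -(c * c) / (R - c) < 0 := div_neg_of_neg_of_pos (by nlinarith) hd
    linarith
  · intro h y
    obtain ⟨a, ha, h⟩ := hf.mem_subdifferential_iff.1 h
    rcases eq_or_ne (f y) ⊤ with hy | hy
    · rw [hy, EReal.top_add_coe]; exact le_top
    have hs := (EReal.coe_toReal hy (hf.ne_bot y)).symm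
    have h1 := h y
    rw [hs, EReal.coe_le_coe_iff] at h1
    rw [ha, hs, ← EReal.coe_add, ← EReal.coe_add, EReal.coe_le_coe_iff, quad_eq hLM b δ p x y]
    have : 0 ≤ 1 / 2 * ‖L (y - x)‖ ^ 2 + δ / 2 * ‖y - x‖ ^ 2 := by positivity
    linarith

theorem continuous_quad [FiniteDimensional ℝ E] (L : E →ₗ[ℝ] F) (b : F) (δ : ℝ) (p : E) :
    Continuous (quad L b δ p) := by
  have hL : Continuous L := L.continuous_of_finiteDimensional
  unfold quad
  fun_prop

/-- For `δ > 0` the regularized problem has a solution. -/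
theorem IsGammaZero.exists_isMin_add_quad [FiniteDimensional ℝ E] (hf : IsGammaZero f)
    (L : E →ₗ[ℝ] F) (b : F) {δ : ℝ} (hδ : 0 < δ) (p : E) :
    ∃ x, ∀ y, f x + (quad L b δ p x : EReal) ≤ f y + (quad L b δ p y : EReal) := by
  obtain ⟨K, hK, hfK⟩ := hf.exists_linear_lower_bound
  obtain ⟨x₀, a, ha⟩ := hf.exists_eq_coe
  set V := a + quad L b δ p x₀ with hV
  -- Outside this radius the quadratic growth beats the linear lower bound and the value at `x₀`.
  set R := 2 / δ * (K + ‖p‖ + K + |V|) + 1 + ‖x₀‖ with hR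
  have hout : ∀ y, R < ‖y‖ → (V : EReal) ≤ f y + (quad L b δ p y : EReal) := by
    intro y hy
    have h1 : ((-(K * (1 + ‖y‖)) + quad L b δ p y : ℝ) : EReal)
        ≤ f y + (quad L b δ p y : EReal) := by
      rw [EReal.coe_add]; exact add_le_add_left (hfK y) _
    refine le_trans ?_ h1
    rw [EReal.coe_le_coe_iff]
    have h2 : ⟪y, p⟫_ℝ ≤ ‖y‖ * ‖p‖ := real_inner_le_norm _ _
    have h3 : δ / 2 * ‖y‖ ^ 2 - ‖y‖ * ‖p‖ ≤ quad L b δ p y := by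
      unfold quad; nlinarith [sq_nonneg ‖L y - b‖]
    have h4 : 1 ≤ ‖y‖ := by
      have : 0 ≤ 2 / δ * (K + ‖p‖ + K + |V|) := by positivity
      linarith [norm_nonneg x₀]
    have h5 : K + ‖p‖ + K + |V| ≤ δ / 2 * ‖y‖ := by
      have h6 : 2 / δ * (K + ‖p‖ + K + |V|) ≤ ‖y‖ := by linarith [norm_nonneg x₀]
      have h7 := mul_le_mul_of_nonneg_left h6 (half_pos hδ).le
      have h8 : δ / 2 * (2 / δ * (K + ‖p‖ + K + |V|)) = K + ‖p‖ + K + |V| := by field_simp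
      linarith
    have h9 := mul_le_mul_of_nonneg_right h5 (norm_nonneg y)
    have h10 : K ≤ K * ‖y‖ := le_mul_of_one_le_right hK h4
    have h11 : |V| ≤ |V| * ‖y‖ := le_mul_of_one_le_right (abs_nonneg V) h4
    nlinarith [le_abs_self V]
  have hlsc : LowerSemicontinuous fun y => f y + (quad L b δ p y : EReal) := by
    refine hf.lsc.add' (continuous_coe_real_ereal.comp
      (continuous_quad L b δ p)).lowerSemicontinuous fun x => ?_
    exact EReal.continuousAt_add (Or.inr (EReal.coe_ne_bot _)) (Or.inr (EReal.coe_ne_top _))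
  have hx₀R : x₀ ∈ Metric.closedBall (0 : E) R := by
    have : 0 ≤ 2 / δ * (K + ‖p‖ + K + |V|) := by positivity
    rw [mem_closedBall_zero_iff]; linarith
  obtain ⟨x, -, hx⟩ := LowerSemicontinuousOn.exists_isMinOn
    ⟨x₀, hx₀R⟩ (isCompact_closedBall (0 : E) R) (hlsc.lowerSemicontinuousOn _)
  refine ⟨x, fun y => ?_⟩
  rcases le_or_gt ‖y‖ R with hy | hy
  · exact hx (show y ∈ Metric.closedBall (0 : E) R by rwa [mem_closedBall_zero_iff])
  · refine le_trans (hx hx₀R) (le_trans ?_ (hout y hy))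
    show f x₀ + _ ≤ _
    rw [ha, ← EReal.coe_add]

/-- Solvability of the regularized inclusion; with `L = 0` and `δ = 1` this is the existence of
proximal points. -/
theorem IsGammaZero.exists_regularized [FiniteDimensional ℝ E] (hf : IsGammaZero f)
    {L : E →ₗ[ℝ] F} {M : F →ₗ[ℝ] E} (hLM : ∀ x y, ⟪L x, y⟫_ℝ = ⟪x, M y⟫_ℝ) (b : F) {δ : ℝ}
    (hδ : 0 < δ) (p : E) : ∃ x, p + M (b - L x) - δ • x ∈ subdifferential f x := by
  obtain ⟨x, hx⟩ := hf.exists_isMin_add_quad L b hδ p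
  exact ⟨x, (hf.isMin_add_quad_iff hLM b hδ.le p x).1 hx⟩

theorem IsGammaZero.exists_prox [FiniteDimensional ℝ E] (hf : IsGammaZero f) (z : E) :
    ∃ x, z - x ∈ subdifferential f x := by
  obtain ⟨x, hx⟩ := hf.exists_regularized (L := (0 : E →ₗ[ℝ] E)) (M := 0) (by simp) 0 one_pos z
  exact ⟨x, by simpa using hx⟩

end Quadratic

/-! ### Conjugation -/

section Conjugate

variable {E F : Type*} [NormedAddCommGroup E] [InnerProductSpace ℝ E]
  [NormedAddCommGroup F] [InnerProductSpace ℝ F] {f : E → EReal}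

theorem conjugate_le_coe_iff (hb : ∀ x, f x ≠ ⊥) {u : E} {K : ℝ} :
    conjugate f u ≤ K ↔ ∀ x, ((⟪x, u⟫_ℝ - K : ℝ) : EReal) ≤ f x := by
  unfold conjugate
  rw [iSup_le_iff]
  refine forall_congr' fun x => ?_
  rcases eq_or_ne (f x) ⊤ with hx | hx
  · simp [hx]
  · rw [← EReal.coe_toReal hx (hb x), ← EReal.coe_sub, EReal.coe_le_coe_iff, EReal.coe_le_coe_iff]
    constructor <;> intro h <;> linarith

theorem IsGammaZero.conjugate_ne_bot (hf : IsGammaZero f) (u : E) : conjugate f u ≠ ⊥ := by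
  obtain ⟨x, a, ha⟩ := hf.exists_eq_coe
  have h : ((⟪x, u⟫_ℝ : ℝ) : EReal) - f x ≤ conjugate f u :=
    le_iSup (fun x => ((⟪x, u⟫_ℝ : ℝ) : EReal) - f x) x
  rw [ha, ← EReal.coe_sub] at h
  exact ne_bot_of_le_ne_bot (EReal.coe_ne_bot _) h

/-- Equality in the Fenchel–Young inequality along the graph of the subdifferential. -/
theorem IsGammaZero.conjugate_eq_of_mem (hf : IsGammaZero f) {x u : E} {a : ℝ} (ha : f x = a)
    (hu : u ∈ subdifferential f x) : conjugate f u = ((⟪x, u⟫_ℝ - a : ℝ) : EReal) := by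
  apply le_antisymm
  · rw [conjugate_le_coe_iff hf.ne_bot]
    intro y
    have h := hu y
    rw [ha, ← EReal.coe_add] at h
    convert h using 2
    rw [inner_sub_left]; ring
  · have h : ((⟪x, u⟫_ℝ : ℝ) : EReal) - f x ≤ conjugate f u :=
      le_iSup (fun x => ((⟪x, u⟫_ℝ : ℝ) : EReal) - f x) x
    rwa [ha, ← EReal.coe_sub] at h

theorem lowerSemicontinuous_conjugate (hb : ∀ x, f x ≠ ⊥) :
    LowerSemicontinuous (conjugate f) := by
  refine lowerSemicontinuous_iSup fun x => Continuous.lowerSemicontinuous ?_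
  rcases eq_or_ne (f x) ⊤ with hx | hx
  · simpa [hx] using continuous_const
  · rw [← EReal.coe_toReal hx (hb x)]
    simp only [← EReal.coe_sub]
    exact continuous_coe_real_ereal.comp (by fun_prop)

/-- The effective domain `dom f*` of the conjugate. -/
def conjDom (f : E → EReal) : Set E := {u | ∃ K : ℝ, conjugate f u ≤ K}

theorem conjugate_convex_comb_le (hb : ∀ x, f x ≠ ⊥) {u v : E} {K K' s t : ℝ}
    (hu : conjugate f u ≤ K) (hv : conjugate f v ≤ K') (hs : 0 ≤ s) (ht : 0 ≤ t)
    (hst : s + t = 1) : conjugate f (s • u + t • v) ≤ ((s * K + t * K' : ℝ) : EReal) := by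
  rw [conjugate_le_coe_iff hb] at *
  intro x
  rcases eq_or_ne (f x) ⊤ with hx | hx
  · simp [hx]
  have h1 := hu x
  have h2 := hv x
  rw [← EReal.coe_toReal hx (hb x), EReal.coe_le_coe_iff] at *
  rw [inner_add_right, inner_smul_right, inner_smul_right]
  have h3 : (f x).toReal = s * (f x).toReal + t * (f x).toReal := by rw [← add_mul, hst, one_mul]
  nlinarith [mul_le_mul_of_nonneg_left h1 hs, mul_le_mul_of_nonneg_left h2 ht]

theorem IsGammaZero.convex_conjDom (hf : IsGammaZero f) : Convex ℝ (conjDom f) := by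
  rintro u ⟨K, hu⟩ v ⟨K', hv⟩ s t hs ht hst
  exact ⟨_, conjugate_convex_comb_le hf.ne_bot hu hv hs ht hst⟩

theorem IsGammaZero.mem_conjDom (hf : IsGammaZero f) {x u : E} (hu : u ∈ subdifferential f x) :
    u ∈ conjDom f := by
  obtain ⟨a, ha, -⟩ := hf.mem_subdifferential_iff.1 hu
  exact ⟨_, (hf.conjugate_eq_of_mem ha hu).le⟩

theorem IsGammaZero.ran_subset_conjDom (hf : IsGammaZero f) :
    ran (subdifferential f) ⊆ conjDom f := by
  intro u hu
  obtain ⟨x, hx⟩ := Set.mem_iUnion.1 hu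
  exact hf.mem_conjDom hx

/-- `f* ∘ M` belongs to `Γ₀(F)` as soon as `ran M` meets the domain of `f*`. -/
theorem IsGammaZero.conjugate_comp [FiniteDimensional ℝ F] (hf : IsGammaZero f) (M : F →ₗ[ℝ] E)
    {v : F} (hv : M v ∈ conjDom f) : IsGammaZero fun y => conjugate f (M y) where
  ne_bot y := hf.conjugate_ne_bot _
  exists_ne_top := by
    obtain ⟨K, hK⟩ := hv
    exact ⟨v, ne_top_of_le_ne_top (EReal.coe_ne_top _) hK⟩
  lsc := (lowerSemicontinuous_conjugate hf.ne_bot).comp M.continuous_of_finiteDimensional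
  convex_epigraph := by
    rintro ⟨u, K⟩ hu ⟨v, K'⟩ hv s t hs ht hst
    have := conjugate_convex_comb_le hf.ne_bot hu hv hs ht hst
    simpa using this

theorem IsGammaZero.nonempty_ran [FiniteDimensional ℝ E] (hf : IsGammaZero f) :
    (ran (subdifferential f)).Nonempty := by
  obtain ⟨x, hx⟩ := hf.exists_prox 0
  exact ⟨_, Set.mem_iUnion.2 ⟨x, hx⟩⟩

theorem IsGammaZero.conjugate [FiniteDimensional ℝ E] (hf : IsGammaZero f) :
    IsGammaZero (conjugate f) := by
  obtain ⟨u, hu⟩ := hf.nonempty_ran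
  exact hf.conjugate_comp LinearMap.id (v := u) (hf.ran_subset_conjDom hu)

theorem IsGammaZero.mem_subdifferential_conjugate_of_mem (hf : IsGammaZero f) {x u : E}
    (hu : u ∈ subdifferential f x) : x ∈ subdifferential (RegLS.conjugate f) u := by
  obtain ⟨a, ha, -⟩ := hf.mem_subdifferential_iff.1 hu
  intro v
  rw [hf.conjugate_eq_of_mem ha hu, ← EReal.coe_add]
  have h : ((⟪x, v⟫_ℝ : ℝ) : EReal) - f x ≤ RegLS.conjugate f v :=
    le_iSup (fun x => ((⟪x, v⟫_ℝ : ℝ) : EReal) - f x) x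
  rw [ha, ← EReal.coe_sub] at h
  convert h using 2
  rw [inner_sub_left, real_inner_comm x u, real_inner_comm x v]; ring

/-- `∂f*` is the inverse of `∂f`. Instead of the biconjugate theorem, the nontrivial inclusion
uses the proximal point of `x + u` and the monotonicity of `∂f*`. -/
theorem IsGammaZero.mem_subdifferential_conjugate_iff [FiniteDimensional ℝ E]
    (hf : IsGammaZero f) {x u : E} :
    x ∈ subdifferential (RegLS.conjugate f) u ↔ u ∈ subdifferential f x := by
  refine ⟨fun hx => ?_, hf.mem_subdifferential_conjugate_of_mem⟩
  obtain ⟨z, hz⟩ := hf.exists_prox (x + u)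
  have h := hf.conjugate.isMonotone_subdifferential _ _ x hx z
    (hf.mem_subdifferential_conjugate_of_mem hz)
  rw [show u - (x + u - z) = -(x - z) by abel, inner_neg_left, real_inner_self_eq_norm_sq] at h
  have h0 : ‖x - z‖ = 0 := by
    have := sq_nonneg ‖x - z‖
    exact pow_eq_zero_iff two_ne_zero |>.1 (by linarith)
  have hxz : x = z := sub_eq_zero.1 (norm_eq_zero.1 h0)
  subst hxz
  simpa using hz

end Conjugate

/-! ### Solvability by Tikhonov regularization -/

section Existence

variable {E F : Type*} [NormedAddCommGroup E] [InnerProductSpace ℝ E] [FiniteDimensional ℝ E]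
  [NormedAddCommGroup F] [InnerProductSpace ℝ F] {f : E → EReal}

/-- A sequence in a subspace `W` on which every functional `⟪·, w⟫`, with `w ∈ W` small, is bounded
above is bounded in norm (uniform boundedness principle). -/
theorem exists_norm_le_of_inner_le (W : Submodule ℝ E) {x : ℕ → E} (hx : ∀ k, x k ∈ W) {ε : ℝ}
    (hε : 0 < ε) (h : ∀ w ∈ W, ‖w‖ < ε → ∃ C : ℝ, ∀ k, ⟪x k, w⟫_ℝ ≤ C) :
    ∃ C : ℝ, ∀ k, ‖x k‖ ≤ C := by
  have hpt : ∀ w : W, ∃ C, ∀ k, ‖((innerSL ℝ (x k)).comp W.subtypeL) w‖ ≤ C := by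
    intro w
    set c : ℝ := ε / (‖(w : E)‖ + 1) with hc
    have hc0 : 0 < c := by positivity
    have hcw : ‖c • (w : E)‖ < ε := by
      rw [norm_smul, Real.norm_of_nonneg hc0.le, hc, div_mul_eq_mul_div, div_lt_iff₀ (by positivity)]
      nlinarith
    obtain ⟨C₁, h₁⟩ := h (c • (w : E)) (W.smul_mem _ w.2) hcw
    obtain ⟨C₂, h₂⟩ := h (-(c • (w : E))) (W.neg_mem (W.smul_mem _ w.2)) (by rwa [norm_neg])
    refine ⟨max C₁ C₂ / c, fun k => ?_⟩
    have e₁ := h₁ k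
    have e₂ := h₂ k
    rw [inner_neg_right] at e₂
    rw [inner_smul_right] at e₁ e₂
    rw [le_div_iff₀ hc0, ContinuousLinearMap.comp_apply, Submodule.subtypeL_apply,
      innerSL_apply_apply, Real.norm_eq_abs, mul_comm, ← abs_of_pos hc0, ← abs_mul,
      abs_le]
    constructor <;> linarith [le_max_left C₁ C₂, le_max_right C₁ C₂]
  obtain ⟨C, hC⟩ := banach_steinhaus hpt
  refine ⟨C, fun k => ?_⟩
  have h1 := ((innerSL ℝ (x k)).comp W.subtypeL).le_of_opNorm_le (hC k) ⟨x k, hx k⟩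
  rw [ContinuousLinearMap.comp_apply, Submodule.subtypeL_apply, innerSL_apply_apply,
    real_inner_self_eq_norm_sq, Real.norm_of_nonneg (by positivity)] at h1
  change ‖x k‖ ^ 2 ≤ C * ‖x k‖ at h1
  rcases (norm_nonneg (x k)).eq_or_lt with h0 | h0
  · rw [← h0]
    exact (norm_nonneg _).trans (hC k)
  · nlinarith

/-- Key existence result. The Tikhonov-regularized solutions lie in `W`; the affine minorants of
`f` with slopes in `p + W + ran M` bound them, and closedness of the graph of `∂f` lets the
regularization parameter tend to `0`. -/
theorem IsGammaZero.exists_subgradient (hf : IsGammaZero f) {L : E →ₗ[ℝ] F} {M : F →ₗ[ℝ] E}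
    (hLM : ∀ x y, ⟪L x, y⟫_ℝ = ⟪x, M y⟫_ℝ) (W : Submodule ℝ E) (hMW : ∀ y, M y ∈ W) (p : E)
    (hW : ∀ u ∈ ran (subdifferential f), u - p ∈ W) {ε : ℝ} (hε : 0 < ε)
    (h : ∀ w ∈ W, ‖w‖ < ε → ∃ q, p + w + M q ∈ conjDom f) (b : F) :
    ∃ x, p + M (b - L x) ∈ subdifferential f x := by
  set δ : ℕ → ℝ := fun k => 1 / ((k : ℝ) + 1) with hδ
  have hδ0 : ∀ k, 0 < δ k := fun k => Nat.one_div_pos_of_nat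
  have hδ1 : ∀ k, δ k ≤ 1 := fun k => by
    rw [hδ]; exact (div_le_one (by positivity)).2 (by linarith [Nat.cast_nonneg (α := ℝ) k])
  have hδlim : Filter.Tendsto δ Filter.atTop (nhds 0) := tendsto_one_div_add_atTop_nhds_zero_nat
  choose x hx using fun k => hf.exists_isMin_add_quad L b (hδ0 k) p
  have hsub : ∀ k, p + M (b - L (x k)) - δ k • x k ∈ subdifferential f (x k) := fun k =>
    (hf.isMin_add_quad_iff hLM b (hδ0 k).le p (x k)).1 (hx k)
  have hxW : ∀ k, x k ∈ W := by
    intro k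
    have h1 := hW _ (Set.mem_iUnion.2 ⟨x k, hsub k⟩)
    have h2 : δ k • x k ∈ W := by
      have h3 := W.sub_mem (hMW (b - L (x k))) h1
      convert h3 using 1
      abel
    exact (W.smul_mem_iff (hδ0 k).ne').1 h2
  obtain ⟨x₀, a, ha⟩ := hf.exists_eq_coe
  obtain ⟨C, hC⟩ := exists_norm_le_of_inner_le W hxW hε fun w hw hwε => by
    obtain ⟨q, K, hK⟩ := h w hw hwε
    rw [conjugate_le_coe_iff hf.ne_bot] at hK
    refine ⟨K + a + quad L b 1 p x₀ - ⟪b, q⟫_ℝ + 1 / 2 * ‖q‖ ^ 2, fun k => ?_⟩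
    have h1 := (add_le_add_left (hK (x k)) (quad L b (δ k) p (x k) : EReal)).trans (hx k x₀)
    rw [ha, ← EReal.coe_add, ← EReal.coe_add, EReal.coe_le_coe_iff] at h1
    have h2 : quad L b (δ k) p x₀ ≤ quad L b 1 p x₀ := by
      unfold quad
      nlinarith [sq_nonneg ‖x₀‖, hδ1 k]
    have h3 : 1 / 2 * ‖L (x k) - b‖ ^ 2 - ⟪x k, p⟫_ℝ ≤ quad L b (δ k) p (x k) := by
      unfold quad
      nlinarith [mul_nonneg (hδ0 k).le (sq_nonneg ‖x k‖)]
    have h4 : ‖L (x k) - b + q‖ ^ 2 =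
        ‖L (x k) - b‖ ^ 2 + 2 * (⟪L (x k), q⟫_ℝ - ⟪b, q⟫_ℝ) + ‖q‖ ^ 2 := by
      rw [norm_add_sq_real, inner_sub_left]
    rw [inner_add_right, inner_add_right, ← hLM] at h1
    nlinarith [sq_nonneg ‖L (x k) - b + q‖]
  obtain ⟨x', -, φ, hφ, hlim⟩ := tendsto_subseq_of_bounded
    (Metric.isBounded_closedBall (x := (0 : E)) (r := C))
    (fun k => by rw [mem_closedBall_zero_iff]; exact hC k)
  have hcont : Continuous fun z => M (b - L z) := by
    have h1 : Continuous (M ∘ₗ L) := (M ∘ₗ L).continuous_of_finiteDimensional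
    simp only [map_sub]
    exact continuous_const.sub h1
  refine ⟨x', hf.mem_subdifferential_of_tendsto (fun k => hsub (φ k)) hlim ?_⟩
  have h1 : Filter.Tendsto (fun k => p + M (b - L (x (φ k))) - δ (φ k) • x (φ k)) Filter.atTop
      (nhds (p + M (b - L x') - (0 : ℝ) • x')) :=
    (tendsto_const_nhds.add ((hcont.tendsto x').comp hlim)).sub
      ((hδlim.comp hφ.tendsto_atTop).smul hlim)
  simpa using h1

end Existence

/-! ### Relative interiors -/

section RelativeInterior

variable {E : Type*} [NormedAddCommGroup E] [NormedSpace ℝ E]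

/-- A metric description of the relative interior. -/
theorem mem_intrinsicInterior_iff_ball {s : Set E} {z : E} :
    z ∈ intrinsicInterior ℝ s ↔
      z ∈ s ∧ ∃ ε > 0, ∀ w ∈ (affineSpan ℝ s).direction, ‖w‖ < ε → z + w ∈ s := by
  rw [mem_intrinsicInterior]
  constructor
  · rintro ⟨y, hy, rfl⟩
    refine ⟨interior_subset (s := ((↑) ⁻¹' s : Set (affineSpan ℝ s))) hy, ?_⟩
    rw [mem_interior_iff_mem_nhds, Metric.mem_nhds_iff] at hy
    obtain ⟨ε, hε, hball⟩ := hy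
    refine ⟨ε, hε, fun w hw hwε => ?_⟩
    have hmem : (y : E) + w ∈ affineSpan ℝ s := by
      rw [add_comm]; exact AffineSubspace.vadd_mem_of_mem_direction hw y.2
    refine hball (show (⟨(y : E) + w, hmem⟩ : affineSpan ℝ s) ∈ Metric.ball y ε from ?_)
    rw [Metric.mem_ball, Subtype.dist_eq, dist_eq_norm]
    simpa using hwε
  · rintro ⟨hz, ε, hε, h⟩
    have hzm : z ∈ affineSpan ℝ s := subset_affineSpan ℝ s hz
    refine ⟨⟨z, hzm⟩, ?_, rfl⟩
    rw [mem_interior_iff_mem_nhds, Metric.mem_nhds_iff]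
    refine ⟨ε, hε, fun y hy => ?_⟩
    rw [Metric.mem_ball, Subtype.dist_eq, dist_eq_norm] at hy
    have := h ((y : E) - z) (AffineSubspace.vsub_mem_direction y.2 hzm) hy
    simpa using this

/-- A set between `ri t` and `t` has a relative interior containing `ri t`. -/
theorem intrinsicInterior_subset_of_subset {s t : Set E} (hst : s ⊆ t)
    (hts : intrinsicInterior ℝ t ⊆ s) : intrinsicInterior ℝ t ⊆ intrinsicInterior ℝ s := by
  intro z hz
  refine mem_intrinsicInterior_iff_ball.2 ⟨hts hz, ?_⟩
  obtain ⟨-, ε, hε, h⟩ := mem_intrinsicInterior_iff_ball.1 hz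
  have hdir := AffineSubspace.direction_le (affineSpan_mono ℝ hst)
  refine ⟨ε / 2, half_pos hε, fun w hw hwε => hts ?_⟩
  refine mem_intrinsicInterior_iff_ball.2 ⟨h w (hdir hw) (by linarith), ε / 2, half_pos hε,
    fun w' hw' hwε' => ?_⟩
  rw [add_assoc]
  exact h _ (add_mem (hdir hw) hw') ((norm_add_le _ _).trans_lt (by linarith))

/-- A proper convex combination of a point of a convex set and a point of its relative interior
lies in the relative interior. -/
theorem _root_.Convex.smul_add_smul_mem_intrinsicInterior {s : Set E} (hs : Convex ℝ s) {x y : E}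
    (hx : x ∈ s) (hy : y ∈ intrinsicInterior ℝ s) {a b : ℝ} (ha : 0 ≤ a) (hb : 0 < b)
    (hab : a + b = 1) : a • x + b • y ∈ intrinsicInterior ℝ s := by
  obtain ⟨hys, ε, hε, h⟩ := mem_intrinsicInterior_iff_ball.1 hy
  refine mem_intrinsicInterior_iff_ball.2 ⟨hs hx hys ha hb.le hab, b * ε, by positivity,
    fun w hw hwε => ?_⟩
  have h1 : ‖b⁻¹ • w‖ < ε := by
    rw [norm_smul, Real.norm_of_nonneg (by positivity), inv_mul_lt_iff₀ hb]
    exact hwε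
  have h2 := hs hx (h _ (Submodule.smul_mem _ _ hw) h1) ha hb.le hab
  rwa [smul_add, smul_inv_smul₀ hb.ne', ← add_assoc] at h2

/-- In finite dimension, small vectors of `U ⊔ V` decompose with a small component in `U`. -/
theorem exists_small_decomposition [FiniteDimensional ℝ E] (U V : Submodule ℝ E) {ε : ℝ}
    (hε : 0 < ε) :
    ∃ η > 0, ∀ w ∈ U ⊔ V, ‖w‖ < η → ∃ u ∈ U, ∃ v ∈ V, ‖u‖ < ε ∧ u + v = w := by
  set φ : U × V →ₗ[ℝ] E := U.subtype.coprod V.subtype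
  have hrange : LinearMap.range φ = U ⊔ V := by
    rw [LinearMap.range_coprod, Submodule.range_subtype, Submodule.range_subtype]
  obtain ⟨g, hg⟩ := φ.rangeRestrict.exists_rightInverse_of_surjective φ.range_rangeRestrict
  set k : LinearMap.range φ →ₗ[ℝ] U := LinearMap.fst ℝ U V ∘ₗ g
  have hk : Continuous k := k.continuous_of_finiteDimensional
  obtain ⟨η, hη, hball⟩ := Metric.continuousAt_iff.1 (hk.continuousAt (x := 0)) ε hε
  refine ⟨η, hη, fun w hw hwη => ?_⟩
  rw [← hrange] at hw
  have h1 := hball (x := ⟨w, hw⟩) (by simpa using hwη)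
  have h2 : φ (g ⟨w, hw⟩) = w := congrArg Subtype.val (LinearMap.congr_fun hg ⟨w, hw⟩)
  refine ⟨(g ⟨w, hw⟩).1, (g ⟨w, hw⟩).1.2, (g ⟨w, hw⟩).2, (g ⟨w, hw⟩).2.2, ?_, ?_⟩
  · simpa [k] using h1
  · simpa [φ] using h2

/-- If the relative interior of `s` meets the subspace `V`, then `0` is in the relative interior of
`s - V`. Convexity of `s` is not needed for this implication. -/
theorem zero_mem_intrinsicInterior_sub [FiniteDimensional ℝ E] {s : Set E} (V : Submodule ℝ E)
    {z : E} (hz : z ∈ intrinsicInterior ℝ s) (hzV : z ∈ V) :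
    0 ∈ intrinsicInterior ℝ (s - (V : Set E)) := by
  obtain ⟨hzs, ε, hε, h⟩ := mem_intrinsicInterior_iff_ball.1 hz
  obtain ⟨η, hη, hdec⟩ := exists_small_decomposition (affineSpan ℝ s).direction V hε
  refine mem_intrinsicInterior_iff_ball.2 ⟨⟨z, hzs, z, hzV, sub_self z⟩, η, hη,
    fun w hw hwη => ?_⟩
  have hle : (affineSpan ℝ (s - (V : Set E))).direction ≤ (affineSpan ℝ s).direction ⊔ V := by
    rw [direction_affineSpan, direction_affineSpan, vectorSpan_def, Submodule.span_le]
    rintro _ ⟨_, ⟨d, hd, v, hv, rfl⟩, _, ⟨d', hd', v', hv', rfl⟩, rfl⟩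
    have : (d - v) -ᵥ (d' - v') = (d -ᵥ d') + (v' - v) := by
      simp only [vsub_eq_sub]; abel
    show (d - v) -ᵥ (d' - v') ∈ _
    rw [this]
    exact Submodule.add_mem_sup (vsub_mem_vectorSpan ℝ hd hd') (V.sub_mem hv' hv)
  obtain ⟨u, hu, v, hv, huε, rfl⟩ := hdec w (hle hw) hwη
  exact ⟨z + u, h u hu huε, z - v, V.sub_mem hzV hv,
    (by abel : z + u - (z - v) = 0 + (u + v))⟩

/-- If `0` is in the relative interior of `s - V`, then `V` and `s` lie in the direction of the
affine span of `s - V`. -/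
theorem mem_direction_of_zero_mem_sub {s : Set E} (V : Submodule ℝ E)
    (h0 : (0 : E) ∈ s - (V : Set E)) :
    s ⊆ (affineSpan ℝ (s - (V : Set E))).direction ∧
      V ≤ (affineSpan ℝ (s - (V : Set E))).direction := by
  have hmem : ∀ x ∈ s - (V : Set E), x ∈ (affineSpan ℝ (s - (V : Set E))).direction := by
    intro x hx
    have := AffineSubspace.vsub_mem_direction (subset_affineSpan ℝ _ hx)
      (subset_affineSpan ℝ _ h0)
    simpa using this
  refine ⟨fun d hd => hmem d ⟨d, hd, 0, V.zero_mem, sub_zero d⟩, fun v hv => ?_⟩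
  obtain ⟨d, hd, v', hv', hdv⟩ := h0
  obtain rfl : d = v' := sub_eq_zero.1 hdv
  exact hmem v ⟨d, hd, d - v, V.sub_mem hv' hv, (by abel : d - (d - v) = v)⟩

end RelativeInterior

/-! ### The range of the subdifferential -/

section Range

variable {E F : Type*} [NormedAddCommGroup E] [InnerProductSpace ℝ E] [FiniteDimensional ℝ E]
  [NormedAddCommGroup F] [InnerProductSpace ℝ F] {f : E → EReal}

/-- Together with `ran ∂f ⊆ dom f*` this says that `ran ∂f` is nearly convex. -/
theorem IsGammaZero.intrinsicInterior_conjDom_subset (hf : IsGammaZero f) :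
    intrinsicInterior ℝ (conjDom f) ⊆ ran (subdifferential f) := by
  intro p hp
  obtain ⟨hpC, ε, hε, h⟩ := mem_intrinsicInterior_iff_ball.1 hp
  obtain ⟨x, hx⟩ := hf.exists_subgradient (L := (0 : E →ₗ[ℝ] E)) (M := 0) (by simp)
    (affineSpan ℝ (conjDom f)).direction (by simp) p
    (fun u hu => AffineSubspace.vsub_mem_direction
      (subset_affineSpan ℝ _ (hf.ran_subset_conjDom hu)) (subset_affineSpan ℝ _ hpC))
    hε (fun w hw hwε => ⟨0, by simpa using h w hw hwε⟩) 0
  exact Set.mem_iUnion.2 ⟨x, by simpa using hx⟩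

theorem IsGammaZero.exists_subgradient_of_zero_mem (hf : IsGammaZero f) {L : E →ₗ[ℝ] F}
    {M : F →ₗ[ℝ] E} (hLM : ∀ x y, ⟪L x, y⟫_ℝ = ⟪x, M y⟫_ℝ)
    (h : 0 ∈ intrinsicInterior ℝ (ran (subdifferential f) - Set.range M)) (b : F) :
    ∃ x, M (b - L x) ∈ subdifferential f x := by
  rw [← LinearMap.coe_range] at h
  obtain ⟨h0, ε, hε, h⟩ := mem_intrinsicInterior_iff_ball.1 h
  obtain ⟨hs, hV⟩ := mem_direction_of_zero_mem_sub _ h0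
  obtain ⟨x, hx⟩ := hf.exists_subgradient hLM _ (fun y => hV ⟨y, rfl⟩) 0
    (fun u hu => by simpa using hs hu) hε (fun w hw hwε => by
      obtain ⟨d, hd, _, ⟨q, rfl⟩, hdq⟩ := h w hw hwε
      refine ⟨q, ?_⟩
      have : d = 0 + w + M q := sub_eq_iff_eq_add.1 hdq
      exact this ▸ hf.ran_subset_conjDom hd) b
  exact ⟨x, by simpa using hx⟩

theorem IsGammaZero.zero_mem_intrinsicInterior_sub_iff (hf : IsGammaZero f)
    (V : Submodule ℝ E) :
    0 ∈ intrinsicInterior ℝ (ran (subdifferential f) - (V : Set E)) ↔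
      (intrinsicInterior ℝ (ran (subdifferential f)) ∩ (V : Set E)).Nonempty := by
  refine ⟨fun h => ?_, fun ⟨z, hz, hzV⟩ => zero_mem_intrinsicInterior_sub V hz hzV⟩
  obtain ⟨h0, ε, hε, h⟩ := mem_intrinsicInterior_iff_ball.1 h
  obtain ⟨hs, -⟩ := mem_direction_of_zero_mem_sub V h0
  obtain ⟨c, hc⟩ := (hf.nonempty_ran.mono hf.ran_subset_conjDom).intrinsicInterior
    hf.convex_conjDom
  have hcD := hf.intrinsicInterior_conjDom_subset hc
  -- Push slightly from `0` away from `c`: then `-t • c = d - v`, so `d + t • c` lies in `V`.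
  set t := ε / (‖c‖ + 1) with ht
  have ht0 : 0 < t := by positivity
  have htc : ‖-(t • c)‖ < ε := by
    rw [norm_neg, norm_smul, Real.norm_of_nonneg ht0.le, ht, div_mul_eq_mul_div,
      div_lt_iff₀ (by positivity)]
    nlinarith
  obtain ⟨d, hd, v, hv, hdv⟩ := h _ (neg_mem (Submodule.smul_mem _ t (hs hcD))) htc
  have hdv : d - v = -(t • c) := by simpa using hdv
  refine ⟨(1 / (1 + t)) • d + (t / (1 + t)) • c, ?_, ?_⟩
  · refine intrinsicInterior_subset_of_subset hf.ran_subset_conjDom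
      hf.intrinsicInterior_conjDom_subset ?_
    exact hf.convex_conjDom.smul_add_smul_mem_intrinsicInterior (hf.ran_subset_conjDom hd) hc
      (by positivity) (by positivity) (by field_simp)
  · have h1 : (1 / (1 + t)) • d + (t / (1 + t)) • c = (1 / (1 + t)) • v := by
      rw [sub_eq_iff_eq_add.1 hdv]; module
    rw [h1]
    exact V.smul_mem _ hv

end Range

/-! ### Maximal monotonicity of the dual operator -/

section Minty

variable {E F : Type*} [NormedAddCommGroup E] [InnerProductSpace ℝ E]
  [NormedAddCommGroup F] [InnerProductSpace ℝ F] {f : E → EReal}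

/-- The elementary half of Minty's theorem. -/
theorem isMaximallyMonotone_of_surjective {T : F → Set F} (hT : IsMonotone T)
    (h : ∀ b, ∃ u, b - u ∈ T u) : IsMaximallyMonotone T := by
  refine ⟨hT, fun S hS hTS x v hv => ?_⟩
  obtain ⟨u, hu⟩ := h (x + v)
  have h1 := hS x u v hv _ (hTS u hu)
  rw [show v - (x + v - u) = -(x - u) by abel, inner_neg_right, real_inner_self_eq_norm_sq] at h1
  have h0 : ‖x - u‖ = 0 := by
    have := sq_nonneg ‖x - u‖
    exact pow_eq_zero_iff two_ne_zero |>.1 (by linarith)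
  obtain rfl : x = u := sub_eq_zero.1 (norm_eq_zero.1 h0)
  simpa using hu

/-- The easy inclusion of the chain rule for `f* ∘ M`. -/
theorem image_subdifferential_conjugate_subset {L : E →ₗ[ℝ] F} {M : F →ₗ[ℝ] E}
    (hLM : ∀ x y, ⟪L x, y⟫_ℝ = ⟪x, M y⟫_ℝ) (u : F) :
    L '' subdifferential (RegLS.conjugate f) (M u) ⊆
      subdifferential (fun y => RegLS.conjugate f (M y)) u := by
  rintro _ ⟨x, hx, rfl⟩ v
  have h := hx (M v)
  rwa [← map_sub, real_inner_comm, ← hLM, real_inner_comm] at h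

/-- The dual characterization of solvability. When `ran M` meets `ran ∂f`, the operator
`L ∘ ∂f* ∘ M` is contained in the subdifferential of `f* ∘ M ∈ Γ₀(F)`; under maximality the two
agree, and proximal points of `f* ∘ M` give solutions. -/
theorem IsGammaZero.forall_exists_subgradient_iff [FiniteDimensional ℝ E]
    [FiniteDimensional ℝ F] (hf : IsGammaZero f) {L : E →ₗ[ℝ] F}
    {M : F →ₗ[ℝ] E} (hLM : ∀ x y, ⟪L x, y⟫_ℝ = ⟪x, M y⟫_ℝ) :
    (∀ b, ∃ x, M (b - L x) ∈ subdifferential f x) ↔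
      (ran (subdifferential f) ∩ Set.range M).Nonempty ∧
        IsMaximallyMonotone fun u => L '' subdifferential (RegLS.conjugate f) (M u) := by
  constructor
  · intro h
    refine ⟨?_, isMaximallyMonotone_of_surjective ?_ fun b => ?_⟩
    · obtain ⟨x, hx⟩ := h 0
      exact ⟨_, Set.mem_iUnion.2 ⟨x, hx⟩, _, rfl⟩
    · rintro u v _ ⟨x, hx, rfl⟩ _ ⟨y, hy, rfl⟩
      have h1 := hf.conjugate.isMonotone_subdifferential _ _ x hx y hy
      rw [← map_sub, real_inner_comm, ← hLM, real_inner_comm] at h1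
      rwa [← map_sub]
    · obtain ⟨x, hx⟩ := h b
      exact ⟨b - L x, x, hf.mem_subdifferential_conjugate_of_mem hx, by abel⟩
  · rintro ⟨⟨_, hu, v, rfl⟩, hT⟩ b
    have hg := hf.conjugate_comp M (hf.ran_subset_conjDom hu)
    obtain ⟨u, hu⟩ := hg.exists_prox b
    obtain ⟨x, hx, hxu⟩ := hT.2 hg.isMonotone_subdifferential
      (image_subdifferential_conjugate_subset hLM) u hu
    refine ⟨x, hf.mem_subdifferential_conjugate_iff.1 ?_⟩
    rwa [show b - L x = u by rw [hxu]; abel]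

end Minty

/-! ### Least squares on Euclidean space -/

section LeastSquares

variable {m n : ℕ} {f : EuclideanSpace ℝ (Fin n) → EReal} (A : Matrix (Fin m) (Fin n) ℝ)

theorem inner_lin_left (x : EuclideanSpace ℝ (Fin n)) (y : EuclideanSpace ℝ (Fin m)) :
    ⟪lin A x, y⟫_ℝ = ⟪x, lin Aᵀ y⟫_ℝ := by
  have h := Matrix.toEuclideanLin_conjTranspose_eq_adjoint A
  rw [Matrix.conjTranspose_eq_transpose_of_trivial] at h
  rw [lin, lin, h, LinearMap.adjoint_inner_right]

theorem lin_gram (x : EuclideanSpace ℝ (Fin n)) : lin (Aᵀ * A) x = lin Aᵀ (lin A x) := by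
  simp [lin, Matrix.toLpLin_apply, Matrix.mulVec_mulVec]

variable {A}

theorem IsGammaZero.mem_solutionSet_iff (hf : IsGammaZero f) {b : EuclideanSpace ℝ (Fin m)}
    {x : EuclideanSpace ℝ (Fin n)} :
    x ∈ solutionSet f A b ↔ lin Aᵀ (b - lin A x) ∈ subdifferential f x := by
  have h := hf.isMin_add_quad_iff (inner_lin_left A) b le_rfl 0 x
  have hq : ∀ y, quad (lin A) b 0 0 y = 1 / 2 * ‖lin A y - b‖ ^ 2 := fun y => by simp [quad]
  simp only [hq, zero_add, zero_smul, sub_zero] at h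
  exact h

theorem mem_ran_subdiffAddGram_iff {b : EuclideanSpace ℝ (Fin m)} :
    lin Aᵀ b ∈ ran (subdiffAddGram f A) ↔
      ∃ x, lin Aᵀ (b - lin A x) ∈ subdifferential f x := by
  unfold ran subdiffAddGram
  rw [Set.mem_iUnion]
  refine exists_congr fun x => ?_
  rw [Set.add_singleton, Set.mem_image, map_sub, lin_gram]
  constructor
  · rintro ⟨u, hu, h⟩
    rwa [← h, add_sub_cancel_right]
  · exact fun h => ⟨_, h, sub_add_cancel _ _⟩

end LeastSquares

end RegLS

theorem proposition2p3 {m n : ℕ} (f : EuclideanSpace ℝ (Fin n) → EReal)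
    (hf : RegLS.IsGammaZero f) (A : Matrix (Fin m) (Fin n) ℝ) :
    ((∀ b, (RegLS.solutionSet f A b).Nonempty) ↔
      Set.range (RegLS.lin Aᵀ) ⊆ RegLS.ran (RegLS.subdiffAddGram f A)) ∧
    ((∀ b, (RegLS.solutionSet f A b).Nonempty) ↔
      (RegLS.ran (RegLS.subdifferential f) ∩ Set.range (RegLS.lin Aᵀ)).Nonempty ∧
        RegLS.IsMaximallyMonotone (RegLS.conjSubdiffComp f A)) ∧
    (0 ∈ intrinsicInterior ℝ
        (RegLS.ran (RegLS.subdifferential f) - Set.range (RegLS.lin Aᵀ)) →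
      ∀ b, (RegLS.solutionSet f A b).Nonempty) ∧
    (0 ∈ intrinsicInterior ℝ
        (RegLS.ran (RegLS.subdifferential f) - Set.range (RegLS.lin Aᵀ)) ↔
      (intrinsicInterior ℝ (RegLS.ran (RegLS.subdifferential f)) ∩
        Set.range (RegLS.lin Aᵀ)).Nonempty) ∧
    (0 ∈ intrinsicInterior ℝ (RegLS.ran (RegLS.subdifferential f)) →
      ∀ b, (RegLS.solutionSet f A b).Nonempty) := by
  have hsol : ∀ b, (RegLS.solutionSet f A b).Nonempty ↔
      ∃ x, RegLS.lin Aᵀ (b - RegLS.lin A x) ∈ RegLS.subdifferential f x := fun b =>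
    exists_congr fun x => hf.mem_solutionSet_iff
  simp only [hsol]
  have hiff := hf.zero_mem_intrinsicInterior_sub_iff (LinearMap.range (RegLS.lin Aᵀ))
  rw [LinearMap.coe_range] at hiff
  have hex := hf.exists_subgradient_of_zero_mem (RegLS.inner_lin_left A)
  refine ⟨?_, hf.forall_exists_subgradient_iff (RegLS.inner_lin_left A), hex, hiff, fun h => ?_⟩
  · rw [Set.range_subset_iff]
    exact forall_congr' fun b => RegLS.mem_ran_subdiffAddGram_iff.symm
  · exact hex (hiff.2 ⟨0, h, 0, map_zero _⟩)
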